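/- Let $\mathcal A$ be a unital C*-algebra, let $\mathcal S\subseteq\mathcal A$ be an operator system (a complex linear subspace that contains the unit and is closed under the adjoint), let $M_n$ be the algebra of complex $n\times n$ matrices, and let $\phi:\mathcal S\to M_n$ be a linear map. For $m\in\mathbb N$ identify $\mathcal S\otimes M_m$ with the space $M_m(\mathcal S)$ of $m\times m$ matrices over $\mathcal S$ via $[s_{ij}]\mapsto\sum_{i,j}s_{ij}\otimes E_{ij}$, where $E_{ij}$ are the matrix units. An element of $M_m(\mathcal S)$ is called positive ($\succeq 0$) if it is positive in the C*-algebra $M_m(\mathcal A)$. Let $\phi_m=\phi\otimes I_m:\mathcal S\otimes M_m\to M_n\otimes M_m$, so $\phi_m(s\otimes x)=\phi(s)\otimes x$. Call $\phi$ completely positive (cp) if, for every $m$, $\phi_m$ maps positive elements to positive semidefinite matrices; call it co-cp if $t\circ\phi$ is cp, where $t$ is the transpose on $M_n$; and call it decomposable if it is the sum of a cp map and a co-cp map. Let $$J_m(\mathcal S)=\Big\{S=\sum_{i,j=1}^m s_{ij}\otimes E_{ij}\in\mathcal S\otimes M_m:\ S\succeq0\ \text{ and }\ \sum_{i,j=1}^m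 s_{ij}\otimes E_{ji}\succeq0\Big\}.$$ Let $e_1,\dots,e_n$ be the standard basis of $\mathbb C^n$ and $\mathbf e=\sum_{j=1}^n e_j\otimes e_j\in\mathbb C^n\otimes\mathbb C^n$. The dual functional of $\phi$ is the linear functional $s_\phi:\mathcal S\otimes M_n\to\mathbb C$ determined by $s_\phi(s\otimes x)=\langle(\phi(s)\otimes x)\mathbf e,\mathbf e\rangle$, where $\otimes$ on the right is the Kronecker product. **Theorem.** The following statements are equivalent. 1. $\phi$ is decomposable. 2. $\phi_m(S)\succeq0$ for all $m\in\mathbb N$ and all $S\in J_m(\mathcal S)$. 3. $\phi_n(S)\succeq0$ for all $S\in J_n(\mathcal S)$. 4. $s_\phi(S)\ge0$ (that is, $s_\phi(S)$ is real and nonnegative) for all $S\in J_n(\mathcal S)$. -/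

import Mathlib

open scoped ComplexOrder Kronecker

namespace Decomposable

/-- An operator system: a unital self-adjoint complex subspace of a unital C⋆-algebra. -/
structure IsOperatorSystem {A : Type*} [CStarAlgebra A] (S : Submodule ℂ A) : Prop where
  one_mem : (1 : A) ∈ S
  star_mem : ∀ s ∈ S, star s ∈ S

section

variable {A : Type*} [CStarAlgebra A] {S : Submodule ℂ A} {n m : ℕ}

/-- The elementary tensor `s ⊗ x` in `S ⊗ M_m`, under the identification of `S ⊗ M_m` with the
space `M_m(S)` of `m × m` matrices over `S` given by `[s_{ij}] ↦ ∑ s_{ij} ⊗ E_{ij}`. -/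
noncomputable def tmul (s : S) (x : Matrix (Fin m) (Fin m) ℂ) : Matrix (Fin m) (Fin m) S :=
  Matrix.of fun i j => x i j • s

/-- The ampliation `φ_m = φ ⊗ I_m : S ⊗ M_m → M_n ⊗ M_m`, `[s_{ij}] ↦ ∑ φ(s_{ij}) ⊗ E_{ij}`.
Here `M_n ⊗ M_m` is the algebra of matrices with index set `Fin n × Fin m`. -/
noncomputable def ampliation (φ : S →ₗ[ℂ] Matrix (Fin n) (Fin n) ℂ) (m : ℕ) :
    Matrix (Fin m) (Fin m) S →ₗ[ℂ] Matrix (Fin n × Fin m) (Fin n × Fin m) ℂ where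
  toFun X := Matrix.of fun p q => φ (X p.2 q.2) p.1 q.1
  map_add' X Y := by ext p q; simp
  map_smul' c X := by ext p q; simp

/-- `φ_m` is determined by `φ_m(s ⊗ x) = φ(s) ⊗ x`. -/
theorem ampliation_tmul (φ : S →ₗ[ℂ] Matrix (Fin n) (Fin n) ℂ) (s : S)
    (x : Matrix (Fin m) (Fin m) ℂ) : ampliation φ m (tmul s x) = φ s ⊗ₖ x := by
  ext p q
  simp [ampliation, tmul, Matrix.kroneckerMap_apply, mul_comm]

/-- The vector `𝐞 = ∑ j, e_j ⊗ e_j` of `ℂⁿ ⊗ ℂⁿ`. -/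
noncomputable def eVec (n : ℕ) : Fin n × Fin n → ℂ :=
  ∑ j : Fin n, fun p => (Pi.single j 1 : Fin n → ℂ) p.1 * (Pi.single j 1 : Fin n → ℂ) p.2

/-- The dual functional `s_φ : M_n(S) → ℂ`, `s_φ(X) = ⟨φ_n(X) 𝐞, 𝐞⟩`. -/
noncomputable def dualFunctional (φ : S →ₗ[ℂ] Matrix (Fin n) (Fin n) ℂ) : Matrix (Fin n) (Fin n) S →ₗ[ℂ] ℂ where
  toFun X := star (eVec n) ⬝ᵥ (ampliation φ n X).mulVec (eVec n)
  map_add' X Y := by rw [map_add, Matrix.add_mulVec, dotProduct_add]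
  map_smul' c X := by rw [map_smul, Matrix.smul_mulVec, dotProduct_smul, RingHom.id_apply]

/-- `s_φ` is determined by `s_φ(s ⊗ x) = ⟨(φ(s) ⊗ x) 𝐞, 𝐞⟩`. -/
theorem dualFunctional_tmul (φ : S →ₗ[ℂ] Matrix (Fin n) (Fin n) ℂ) (s : S)
    (x : Matrix (Fin n) (Fin n) ℂ) :
    dualFunctional φ (tmul s x) = star (eVec n) ⬝ᵥ (φ s ⊗ₖ x).mulVec (eVec n) := by
  rw [← ampliation_tmul]; rfl

variable [PartialOrder A] [StarOrderedRing A]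

/-- An element of `M_m(S)` is positive if it is positive in the C⋆-algebra `M_m(A)`. -/
def IsPositive (X : Matrix (Fin m) (Fin m) S) : Prop :=
  0 ≤ CStarMatrix.ofMatrix (X.map ((↑) : S → A))

/-- The map `φ : S → M_n` is completely positive. -/
def IsCP (φ : S →ₗ[ℂ] Matrix (Fin n) (Fin n) ℂ) : Prop :=
  ∀ (k : ℕ) (X : Matrix (Fin k) (Fin k) S), IsPositive X → (ampliation φ k X).PosSemidef

/-- The map `φ : S → M_n` is co-cp: its composition with the transpose of `M_n` is cp. -/
def IsCoCP (φ : S →ₗ[ℂ] Matrix (Fin n) (Fin n) ℂ) : Prop :=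
  IsCP ((Matrix.transposeLinearEquiv (Fin n) (Fin n) ℂ ℂ).toLinearMap ∘ₗ φ)

/-- A linear map is decomposable if it is the sum of a cp map and a co-cp map. -/
def IsDecomposable (φ : S →ₗ[ℂ] Matrix (Fin n) (Fin n) ℂ) : Prop :=
  ∃ ψ η : S →ₗ[ℂ] Matrix (Fin n) (Fin n) ℂ, IsCP ψ ∧ IsCoCP η ∧ φ = ψ + η

variable (S) in
/-- The cone `J_m(S)` of positive elements of `M_m(S) = S ⊗ M_m` with positive partial transpose.
The partial transpose sends `∑ s_{ij} ⊗ E_{ij}` to `∑ s_{ij} ⊗ E_{ji}`, so it is the transpose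
`[s_{ij}] ↦ [s_{ji}]` of the matrix over `S` (no adjoints are taken). -/
def J (m : ℕ) : Set (Matrix (Fin m) (Fin m) S) :=
  {X | IsPositive X ∧ IsPositive X.transpose}

end

end Decomposable

namespace Decomposable

/-! Only the passage from a positive dual functional to a decomposition is substantial. The map `X ↦
(X, Xᵀ)` identifies `M_n(S)` with an operator system in `M_n(A) × M_n(A)` whose positive elements
are exactly the images of `J S n`. Hence `s_φ` is a positive functional there, and Krein's theorem
extends it to the whole product. Restricting to the two factors gives positive functionals with
`s_φ(X) = g₁(X) + g₂(Xᵀ)`. A positive functional on `M_n(A)` yields a cp map via its values on `s ⊗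
E_{ij}`, because compressions of positive matrices are positive; the transpose in the second term
makes that part co-cp. -/

theorem exists_eq_star_mul_self {B : Type*} [CStarAlgebra B] [PartialOrder B]
    [StarOrderedRing B] {b : B} (hb : 0 ≤ b) : ∃ c, b = star c * c :=
  CStarAlgebra.nonneg_iff_eq_star_mul_self.1 hb

/-- Krein's extension theorem: a positive functional on an operator system in a unital C⋆-algebra
extends to a positive functional on the whole algebra. -/
theorem exists_positive_extension {B : Type*} [CStarAlgebra B] [PartialOrder B]
    [StarOrderedRing B] {T : Submodule ℂ B} (hT : IsOperatorSystem T) (f : T →ₗ[ℂ] ℂ)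
    (hf : ∀ t : T, 0 ≤ (t : B) → 0 ≤ f t) :
    ∃ g : B →ₗ[ℂ] ℂ, (∀ t : T, g t = f t) ∧ ∀ b, 0 ≤ b → 0 ≤ g b := by
  have hbound : ∀ b : B, IsSelfAdjoint b → 0 ≤ ((‖b‖ : ℂ) • (1 : B)) + b := by
    intro b hb
    have h := (hb.neg).le_algebraMap_norm_self
    rw [norm_neg, neg_le_iff_add_nonneg, Algebra.algebraMap_eq_smul_one] at h
    rwa [Complex.coe_smul]
  let e : T := ⟨1, hT.one_mem⟩
  have hreal : ∀ t : T, IsSelfAdjoint (t : B) → (f t).im = 0 := by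
    intro t ht
    have h1 : 0 ≤ f ((‖(t : B)‖ : ℂ) • e + t) := hf _ (hbound _ ht)
    have h2 : 0 ≤ f e := hf e zero_le_one
    rw [map_add, map_smul] at h1
    have h3 := (Complex.le_def.1 h1).2
    have h4 := (Complex.le_def.1 h2).2
    simp at h3 h4
    simpa [← h4] using h3.symm
  have hre : ∀ t : T, 0 ≤ (t : B) + star (t : B) → 0 ≤ (f t).re := by
    intro t ht
    let t' : T := ⟨star (t : B), hT.star_mem _ t.2⟩
    have h1 : 0 ≤ f (t + t') := hf _ ht
    -- As `i(t - t*)` is self-adjoint, `f` is real on it, so `f t` and `f t*` have equal real parts.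
    have h2 : (f (Complex.I • (t - t'))).im = 0 := by
      apply hreal
      change star (Complex.I • ((t : B) - star (t : B))) = Complex.I • ((t : B) - star (t : B))
      simp [smul_sub]
      abel
    have h3 := (Complex.le_def.1 h1).1
    simp at h2 h3
    linarith
  -- The cone of elements with positive real part contains every skew-adjoint element, so M. Riesz
  -- extension applies to all of `B` as a real space.
  let C : PointedCone ℝ B :=
    { carrier := {b | 0 ≤ b + star b}
      add_mem' := by
        intro a b ha hb
        have h := add_nonneg (Set.mem_ofPred.1 ha) (Set.mem_ofPred.1 hb)
        rw [Set.mem_ofPred, star_add]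
        convert h using 1
        abel
      zero_mem' := by simp
      smul_mem' := by
        rintro ⟨c, hc⟩ b hb
        have h := smul_nonneg hc (Set.mem_ofPred.1 hb)
        rw [Set.mem_ofPred]
        change 0 ≤ c • b + star (c • b)
        rwa [star_smul, star_trivial, ← smul_add] }
  let F : B →ₗ.[ℝ] ℝ :=
    ⟨T.restrictScalars ℝ, Complex.reLm ∘ₗ (f.restrictScalars ℝ)⟩
  obtain ⟨G, hGF, hG⟩ := riesz_extension C F (fun t ht => hre t ht) (fun b => by
    refine ⟨⟨(‖b + star b‖ : ℂ) • (1 : B), T.smul_mem _ hT.one_mem⟩, ?_⟩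
    have h := hbound _ (IsSelfAdjoint.add_star_self b)
    have h1 : 0 ≤ (‖b + star b‖ : ℂ) • (1 : B) := by
      rw [Complex.coe_smul]
      exact smul_nonneg (norm_nonneg _) zero_le_one
    change 0 ≤ (‖b + star b‖ : ℂ) • (1 : B) + b + star ((‖b + star b‖ : ℂ) • (1 : B) + b)
    have h2 := add_nonneg h h1
    simp only [star_add, star_smul, star_one, Complex.star_def, Complex.conj_ofReal]
    convert h2 using 1
    abel)
  have hGT : ∀ t : T, G t = (f t).re := fun t => hGF t
  refine ⟨Module.Dual.extendRCLike (𝕜 := ℂ) G, ?_, ?_⟩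
  · intro t
    have h := hGT (Complex.I • t)
    rw [Module.Dual.extendRCLike_apply]
    have h' : G (Complex.I • (t : B)) = (f (Complex.I • t)).re := h
    apply Complex.ext
    · simp [hGT]
    · simp [h']
  · intro b hb
    -- For skew-adjoint `c`, both `c` and `-c` lie in the cone, so `G` vanishes at `i b` and the
    -- complexified functional is real at `b`.
    have hI : ∀ c : B, c + star c = 0 → 0 ≤ G c := fun c hc => hG c hc.ge
    have hsb := (IsSelfAdjoint.of_nonneg hb).star_eq
    have h1 : 0 ≤ G (Complex.I • b) := hI _ (by simp [hsb])
    have h2 : 0 ≤ G (-(Complex.I • b)) := hI _ (by simp [hsb])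
    rw [map_neg] at h2
    have h3 : G (Complex.I • b) = 0 := by linarith
    rw [Module.Dual.extendRCLike_apply]
    have h4 : 0 ≤ G b := hG b (by
      change 0 ≤ b + star b
      rw [hsb]
      exact add_nonneg hb hb)
    simpa [h3] using h4

/-- Over `ℂ` a matrix with nonnegative quadratic form is automatically Hermitian. -/
theorem posSemidef_of_dotProduct_mulVec_nonneg {ι : Type*} [Fintype ι] [DecidableEq ι]
    {M : Matrix ι ι ℂ} (h : ∀ x : ι → ℂ, 0 ≤ star x ⬝ᵥ M.mulVec x) : M.PosSemidef := by
  refine Matrix.posSemidef_iff_dotProduct_mulVec.2 ⟨?_, h⟩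
  rw [← Matrix.isSymmetric_toEuclideanLin_iff, LinearMap.isSymmetric_iff_inner_map_self_real]
  intro x
  have h1 := (Complex.le_def.1 (h x.ofLp)).2
  rw [inner_conj_symm, ← inner_conj_symm (Matrix.toEuclideanLin M x), eq_comm,
    Complex.conj_eq_iff_im, EuclideanSpace.inner_eq_star_dotProduct, dotProduct_comm]
  exact h1.symm

section

variable {A : Type*} [CStarAlgebra A] {S : Submodule ℂ A} {n m : ℕ}

theorem dualFunctional_apply (φ : S →ₗ[ℂ] Matrix (Fin n) (Fin n) ℂ)
    (X : Matrix (Fin n) (Fin n) S) :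
    dualFunctional φ X = ∑ i, ∑ j, φ (X i j) i j := by
  have he : ∀ p : Fin n × Fin n, eVec n p = if p.1 = p.2 then 1 else 0 := by
    intro p
    simp [eVec, Finset.sum_apply, Pi.single_apply, eq_comm]
  simp [dualFunctional, ampliation, dotProduct, Matrix.mulVec, Fintype.sum_prod_type, he]

/-- The map `S → M_n` with entries `s ↦ f(s ⊗ E_{ij})`, for a functional `f` on `M_n(A)`. -/
noncomputable def ofFunctional (S : Submodule ℂ A) (f : CStarMatrix (Fin n) (Fin n) A →ₗ[ℂ] ℂ) :
    S →ₗ[ℂ] Matrix (Fin n) (Fin n) ℂ where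
  toFun s := Matrix.of fun i j => f (CStarMatrix.ofMatrix (Matrix.single i j (s : A)))
  map_add' s t := by
    ext i j
    simp [Matrix.single_add, ← CStarMatrix.of_add_of]
  map_smul' c s := by
    ext i j
    simp [← Matrix.smul_single, ← CStarMatrix.smul_of]

theorem sum_ofFunctional_apply (f : CStarMatrix (Fin n) (Fin n) A →ₗ[ℂ] ℂ)
    (X : Matrix (Fin n) (Fin n) S) :
    ∑ i, ∑ j, ofFunctional S f (X i j) i j =
      f (CStarMatrix.ofMatrix (X.map ((↑) : S → A))) := by
  conv_rhs => rw [Matrix.matrix_eq_sum_single (X.map ((↑) : S → A))]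
  have h : ∀ Y : Matrix (Fin n) (Fin n) A,
      CStarMatrix.ofMatrix Y = CStarMatrix.ofMatrixₗ (R := ℂ) Y := fun _ => rfl
  simp only [h, map_sum]
  rfl

variable (S n) in
/-- The embedding `X ↦ (X, Xᵀ)` of `M_n(S)` in `M_n(A) × M_n(A)`. -/
noncomputable def pairTranspose : Matrix (Fin n) (Fin n) S →ₗ[ℂ]
    CStarMatrix (Fin n) (Fin n) A × CStarMatrix (Fin n) (Fin n) A where
  toFun X := (CStarMatrix.ofMatrix (X.map (↑)), CStarMatrix.ofMatrix (X.transpose.map (↑)))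
  map_add' _ _ := rfl
  map_smul' _ _ := rfl

theorem pairTranspose_injective : Function.Injective (pairTranspose S n) := by
  intro X Y h
  ext i j
  exact congrFun (congrFun (congrArg Prod.fst h) i) j

variable [PartialOrder A] [StarOrderedRing A]

/-- Compression of a positive element of `M_m(A)` by a scalar `m × n` matrix is positive. -/
theorem compression_nonneg {Y : CStarMatrix (Fin m) (Fin m) A} (hY : 0 ≤ Y)
    (v : Matrix (Fin m) (Fin n) ℂ) :
    0 ≤ (CStarMatrix.ofMatrix (Matrix.of fun i j =>
      ∑ p, ∑ q, (star (v p i) * v q j) • Y p q) : CStarMatrix (Fin n) (Fin n) A) := by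
  obtain ⟨Z, rfl⟩ := exists_eq_star_mul_self hY
  -- With `Y = Z* Z` the compression is `(Zv)* (Zv)`, but `Zv` is not square. Each row `l` of `Zv`
  -- is therefore placed in row `i₀` of a square matrix, and the squares are summed.
  let R : Fin m → Fin n → CStarMatrix (Fin n) (Fin n) A := fun l i₀ =>
    CStarMatrix.ofMatrix (Matrix.of fun i j => if i = i₀ then ∑ q, v q j • Z l q else 0)
  rcases isEmpty_or_nonempty (Fin n) with hn | ⟨⟨i₀⟩⟩
  · exact le_of_eq (CStarMatrix.ext fun i => isEmptyElim i)
  have h : (CStarMatrix.ofMatrix (Matrix.of fun i j =>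
      ∑ p, ∑ q, (star (v p i) * v q j) • (star Z * Z) p q) : CStarMatrix (Fin n) (Fin n) A) =
      ∑ l, star (R l i₀) * R l i₀ := by
    have hsum : ∀ (F : Fin m → CStarMatrix (Fin n) (Fin n) A) (i j : Fin n),
        (∑ l, F l) i j = ∑ l, F l i j := fun F i j => Matrix.sum_apply i j _ F
    ext i j
    rw [hsum]
    simp only [CStarMatrix.mul_apply, CStarMatrix.star_apply, R, CStarMatrix.ofMatrix_apply,
      Matrix.of_apply, apply_ite star, star_zero, ite_mul, zero_mul, mul_ite, mul_zero,
      star_sum, star_smul, Finset.sum_mul_sum, smul_mul_smul_comm, Finset.smul_sum]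
    simp only [Finset.sum_ite_eq', Finset.mem_univ, if_true]
    conv_rhs => rw [Finset.sum_comm]
    exact Finset.sum_congr rfl fun p _ => Finset.sum_comm
  rw [h]
  exact Finset.sum_nonneg fun l _ => star_mul_self_nonneg _

theorem isCP_ofFunctional {f : CStarMatrix (Fin n) (Fin n) A →ₗ[ℂ] ℂ}
    (hf : ∀ Y, 0 ≤ Y → 0 ≤ f Y) : IsCP (ofFunctional S f) := by
  intro k X hX
  have key : ∀ x : Fin n × Fin k → ℂ,
      0 ≤ star x ⬝ᵥ (ampliation (ofFunctional S f) k X).mulVec x := by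
    intro x
    -- Reshaping `x` into a `k × n` matrix turns the quadratic form at `x` into `f` of the
    -- compression of `X`.
    let W : Matrix (Fin n) (Fin n) S := Matrix.of fun i j =>
      ∑ p, ∑ q, (star (x (i, p)) * x (j, q)) • X p q
    have h1 : star x ⬝ᵥ (ampliation (ofFunctional S f) k X).mulVec x =
        ∑ i, ∑ j, ofFunctional S f (W i j) i j := by
      simp only [dotProduct, Matrix.mulVec, ampliation, Fintype.sum_prod_type, W,
        LinearMap.coe_mk, AddHom.coe_mk, Matrix.of_apply, map_sum, map_smul, Matrix.sum_apply,
        Matrix.smul_apply, smul_eq_mul, Finset.mul_sum, Pi.star_apply]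
      refine Finset.sum_congr rfl fun i _ => ?_
      rw [Finset.sum_comm]
      refine Finset.sum_congr rfl fun j _ => Finset.sum_congr rfl fun p _ =>
        Finset.sum_congr rfl fun q _ => by ring
    rw [h1, sum_ofFunctional_apply]
    apply hf
    have h2 := compression_nonneg hX (Matrix.of fun p i => x (i, p))
    convert h2 using 2
    ext i j
    simp [W]
  exact posSemidef_of_dotProduct_mulVec_nonneg key

/-- The full transpose of `(t ∘ η)_m(Xᵀ)` is `η_m(X)`, and full transposition preserves positivity.
-/
theorem ampliation_posSemidef_of_isCoCP {η : S →ₗ[ℂ] Matrix (Fin n) (Fin n) ℂ} (hη : IsCoCP η)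
    {X : Matrix (Fin m) (Fin m) S} (hX : IsPositive X.transpose) :
    (ampliation η m X).PosSemidef := by
  have h := (hη m _ hX).transpose
  exact h

theorem IsDecomposable.ampliation_posSemidef {φ : S →ₗ[ℂ] Matrix (Fin n) (Fin n) ℂ}
    (hφ : IsDecomposable φ) {X : Matrix (Fin m) (Fin m) S} (hX : X ∈ J S m) :
    (ampliation φ m X).PosSemidef := by
  obtain ⟨ψ, η, hψ, hη, rfl⟩ := hφ
  have h : ampliation (ψ + η) m X = ampliation ψ m X + ampliation η m X := by
    ext p q
    simp [ampliation]
  rw [h]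
  exact (hψ m X hX.1).add (ampliation_posSemidef_of_isCoCP hη hX.2)

theorem isOperatorSystem_range_pairTranspose (hS : IsOperatorSystem S) :
    IsOperatorSystem (LinearMap.range (pairTranspose S n)) where
  one_mem := by
    refine ⟨Matrix.of fun i j => if i = j then ⟨1, hS.one_mem⟩ else 0, Prod.ext ?_ ?_⟩
    · ext i j
      change ((if i = j then ⟨1, hS.one_mem⟩ else 0 : S) : A) = if i = j then 1 else 0
      split_ifs <;> rfl
    · ext i j
      change ((if j = i then ⟨1, hS.one_mem⟩ else 0 : S) : A) = if i = j then 1 else 0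
      simp only [eq_comm (a := j)]
      split_ifs <;> rfl
  star_mem := by
    rintro _ ⟨X, rfl⟩
    exact ⟨Matrix.of fun i j => ⟨star (X j i : A), hS.star_mem _ (X j i).2⟩, rfl⟩

theorem isDecomposable_of_dualFunctional_nonneg (hS : IsOperatorSystem S)
    (φ : S →ₗ[ℂ] Matrix (Fin n) (Fin n) ℂ) (h : ∀ X ∈ J S n, 0 ≤ dualFunctional φ X) :
    IsDecomposable φ := by
  let E := LinearEquiv.ofInjective (pairTranspose S n) pairTranspose_injective
  obtain ⟨g, hg, hpos⟩ := exists_positive_extension (isOperatorSystem_range_pairTranspose hS)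
    (dualFunctional φ ∘ₗ E.symm.toLinearMap) (by
      intro t ht
      obtain ⟨X, rfl⟩ := E.surjective t
      have h1 : 0 ≤ pairTranspose S n X := ht
      simpa using h X ⟨h1.1, h1.2⟩)
  have hext : ∀ X, g (pairTranspose S n X) = dualFunctional φ X := by
    intro X
    simpa [E] using hg (E X)
  let g₁ := g ∘ₗ LinearMap.inl ℂ _ _
  let g₂ := g ∘ₗ LinearMap.inr ℂ _ _
  have hg₁ : ∀ Y, 0 ≤ Y → 0 ≤ g₁ Y := fun Y hY => hpos _ ⟨hY, le_rfl⟩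
  have hg₂ : ∀ Y, 0 ≤ Y → 0 ≤ g₂ Y := fun Y hY => hpos _ ⟨le_rfl, hY⟩
  refine ⟨ofFunctional S g₁, (Matrix.transposeLinearEquiv (Fin n) (Fin n) ℂ ℂ).toLinearMap ∘ₗ
    ofFunctional S g₂, isCP_ofFunctional hg₁, isCP_ofFunctional hg₂, ?_⟩
  ext s i j
  -- Testing on `s ⊗ E_{ij}` isolates the `(i, j)` entry of `φ s`; the second factor sees `s ⊗
  -- E_{ji}`, whence the transpose.
  have h1 := hext (Matrix.single i j s)
  rw [dualFunctional_apply] at h1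
  have h2 : ∑ k, ∑ l, φ (Matrix.single i j s k l) k l = φ s i j := by
    rw [Finset.sum_eq_single i, Finset.sum_eq_single j]
    · simp
    · intro l _ hl
      simp [hl.symm]
    · simp
    · intro k _ hk
      simp [hk.symm]
    · simp
  have h3 : pairTranspose S n (Matrix.single i j s) =
      (CStarMatrix.ofMatrix (Matrix.single i j (s : A)), 0) +
        (0, CStarMatrix.ofMatrix (Matrix.single j i (s : A))) := by
    have hmap : ∀ k l : Fin n, (Matrix.single k l s).map ((↑) : S → A) =
        Matrix.single k l (s : A) := fun k l => Matrix.map_single k l s S.subtype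
    rw [Prod.mk_add_mk, add_zero, zero_add, ← hmap, ← hmap, ← Matrix.transpose_single]
    rfl
  rw [h2, h3, map_add] at h1
  exact h1.symm

end

end Decomposable

theorem mainTheorem1 {A : Type*} [CStarAlgebra A] [PartialOrder A] [StarOrderedRing A]
    (S : Submodule ℂ A) (hS : Decomposable.IsOperatorSystem S) (n : ℕ)
    (φ : S →ₗ[ℂ] Matrix (Fin n) (Fin n) ℂ) :
    List.TFAE [
      Decomposable.IsDecomposable φ,
      ∀ (m : ℕ), ∀ X ∈ Decomposable.J S m, (Decomposable.ampliation φ m X).PosSemidef,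
      ∀ X ∈ Decomposable.J S n, (Decomposable.ampliation φ n X).PosSemidef,
      ∀ X ∈ Decomposable.J S n, 0 ≤ Decomposable.dualFunctional φ X] := by
  tfae_have 1 → 2 := fun h m X hX => h.ampliation_posSemidef hX
  tfae_have 2 → 3 := fun h => h n
  tfae_have 3 → 4 := fun h X hX => (h X hX).dotProduct_mulVec_nonneg _
  tfae_have 4 → 1 := Decomposable.isDecomposable_of_dualFunctional_nonneg hS φ
  tfae_finish
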